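/- **Setting.** Let $G'=(V',E')$ be a finite simple graph (the cropped subgrid), $\mathcal A$ a finite set of participating agents, $S:\mathcal A\to V'$ injective (starts) and $T:\mathcal A\to V'$ (local targets). A configuration places the agents on distinct vertices; unoccupied vertices are *blanks*. In one time step every agent waits or moves to an adjacent vertex, so that no two agents meet in a vertex or exchange places across an edge. *Push-and-Rotate (PnR)* starts in the configuration $S$ with the set $F=\varnothing$ of finished agents. While $F\ne\mathcal A$ it chooses an agent $r\notin F$ and a shortest path $p$ from the position of $r$ to $T(r)$ that avoids the vertices occupied by $F$. Until $r$ is at $T(r)$ it repeats, with $u$ the next vertex of $p$: 1. if $u$ is blank, *move* $r$ to $u$; 2. otherwise, if possible, *rotate*: choose a simple cycle that contains the step from the position of $r$ to $u$, avoids the vertices of $F$ and carries a blank, and let each agent on it go to the next vertex of the cycle; 3. otherwise, if possible, *push* the blocker $b\notin F$ at $u$: choose a simple path from $u$ to a blank that avoids the vertices of $F$ and the position of $r$, and let each agent on it go one vertex towards the blank, so that $u$ becomes blank (optionally after a *clear* step, which shifts one blank in the same way along a path that also avoids $u$), every component having at least two blanks throughout; 4. otherwise, if possible, *swap*: in at most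 $c$ time steps inside a block (maximal connected subgraph without cut vertex) that contains the position of $r$, the vertex $u$ and a blank, exchange $r$ with the blocker $b\notin F$ at $u$; finished agents and agents outside the block do not move, and all other agents end where they were. When $r$ reaches $T(r)$ it is added to $F$. If none of 1–4 is possible, or no path $p$ exists, the run stops without a solution. In a rotation, push or clear step every displaced agent makes its move once, the moves being carried out one after another or simultaneously. Here $c$ is a fixed constant; all choices left open are arbitrary. The *plan* $\Pi$ is the sequence of configurations produced, its *horizon* $L$ the number of its time steps, and the *dense waypoint list* $W_a$ of agent $a$ is the sequence of cell centers in $\mathbb R^2$ of the vertices that $a$ visits in $\Pi$ (its start included), with consecutive waits collapsed. *Execution.* Fix constants $d$ and $\varepsilon,\Delta t,v_{\max},\delta>0$ and an integer $M\ge1$. Centers of adjacent cells are at distance at most $d$, and each agent is initially at distance at most $d$ from the center of its start cell. Positions satisfy $p_a(t+1)=p_a(t)+\Delta t\,v_a(t+1)$ with $\|v_a(t)\|\le v_{\max}$. The first waypoint of $W_a$ is active at tick $0$, and at tick $t+1$ the next one becomes active exactly if at tick $t$ the agent is within $\varepsilon$ of the active one. *Tracking* means: if the active waypoint $w$ of $a$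 is the same at ticks $t$ and $t+M$, then $\|p_a(t+M)-w\|\le\max(\|p_a(t)-w\|-\delta,\ \varepsilon)$. A tick is *under coordination* if some agent has not completed its list. **Theorem (polynomially bounded coordination overhead).** For every $c$ there are polynomials $P_{\rm ops},P_{\rm hor},P_{\rm way}$ in two variables with coefficients in $\mathbb N$ such that, for every instance in which each connected component of $G'$ has at least two blanks in the start configuration, every run of PnR satisfies, at each of its stages (in particular when it returns): the number of emitted primitive operations (moves, rotations, pushes and swaps) is at most $P_{\rm ops}(|V'|,|\mathcal A|)$, the horizon satisfies $L\le P_{\rm hor}(|V'|,|\mathcal A|)$, and $\sum_{a\in\mathcal A}|W_a|\le P_{\rm way}(|V'|,|\mathcal A|)$. Moreover, for all constants $c,d,\varepsilon,\Delta t,v_{\max},\delta,M$ there is such a polynomial $P_{\rm exec}$ with the following property: under the same precondition, in every execution tracking the dense waypoint lists, the number of ticks under coordination is finite and at most $P_{\rm exec}(|V'|,|\mathcal A|)$; hence for every $N\ge1$ the fraction of ticks under coordination among the first $N$ ticks after the trigger (the duty cycle) is at most $P_{\rm exec}(|V'|,|\mathcal A|)/N$. -/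

import Mathlib

namespace PnR

universe u v

variable {V : Type u} {A : Type v}

/-! ## Local multi-agent path finding instances

A configuration with at most one agent per vertex is given by the injective position map
`A → V` of the agents, the inverse of the partial occupancy map `V → A ∪ {⊥}`. -/

/-- A local MAPF instance: a graph, starts (pairwise distinct) and targets. -/
structure LocalInstance (V : Type u) (A : Type v) where
  graph : SimpleGraph V
  start : A → V
  target : A → V
  start_injective : Function.Injective start

/-- `v` is a blank of the configuration `q`. -/
def IsBlank (q : A → V) (v : V) : Prop := v ∉ Set.range q

/-- Every connected component of `G` has at least two blanks in the configuration `q`. -/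
def TwoBlanks (G : SimpleGraph V) (q : A → V) : Prop :=
  ∀ C : G.ConnectedComponent, 2 ≤ {v ∈ C.supp | IsBlank q v}.ncard

/-- One collision-free discrete time step: each agent waits or moves to an adjacent vertex, no two
agents meet in a vertex, and no two agents traverse an edge in opposite directions. -/
structure Transition (G : SimpleGraph V) (q q' : A → V) : Prop where
  wait_or_adj : ∀ a, q' a = q a ∨ G.Adj (q a) (q' a)
  source_injective : Function.Injective q
  target_injective : Function.Injective q'
  no_exchange : ∀ a b, a ≠ b → ¬ (q' a = q b ∧ q' b = q a)

/-- The list `l` (the configurations after the successive time steps) carries out the displacement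
`q ⇒ q'`: every step is a legal transition that moves somebody, and every agent goes from `q a` to
`q' a` in at most one move. The agents may move one after another or simultaneously. -/
def Realizes (G : SimpleGraph V) (q q' : A → V) (l : List (A → V)) : Prop :=
  List.IsChain (fun x y => Transition G x y ∧ x ≠ y ∧
    ∀ a, y a = x a ∨ (x a = q a ∧ y a = q' a)) (q :: l) ∧
  l.getLastD q = q'

/-- Every agent on the walk `w` (except one at its last vertex, unless this is also the first one)
goes to the next vertex of `w`; all agents off the walk stay. -/
def ShiftAlong {G : SimpleGraph V} {x y : V} (w : G.Walk x y) (q q' : A → V) : Prop :=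
  (∀ a, ∀ i < w.length, q a = w.getVert i → q' a = w.getVert (i + 1)) ∧
  (∀ a, q a ∉ w.support → q' a = q a)

/-! ## The primitives

`F` is the set of finished agents, `r` the active agent, `u` the next vertex on its path. Each
relation describes the list `l` of configurations appended to the plan and the resulting
configuration `q'`. -/

/-- The active agent moves to the blank vertex `u`. -/
def Move (G : SimpleGraph V) (r : A) (u : V) (q : A → V) (l : List (A → V)) (q' : A → V) : Prop :=
  IsBlank q u ∧ q' r = u ∧ (∀ a, a ≠ r → q' a = q a) ∧ Transition G q q' ∧ l = [q']

/-- Rotation along a simple cycle through the step from the position of `r` to `u`, which avoids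
the finished agents and carries a blank: each agent on the cycle goes to the next vertex.
(A simple cycle always lies within a single block.) -/
def Rotate (G : SimpleGraph V) (F : Set A) (r : A) (u : V)
    (q : A → V) (l : List (A → V)) (q' : A → V) : Prop :=
  ∃ Z : G.Walk (q r) (q r), Z.IsCycle ∧ Z.getVert 1 = u ∧
    (∀ v ∈ Z.support, v ∉ q '' F) ∧ (∃ v ∈ Z.support, IsBlank q v) ∧
    ShiftAlong Z q q' ∧ Realizes G q q' l

/-- A blank is transported to `x` along a simple path from `x` to the blank that avoids the
vertices in `X`: every agent on the path goes one vertex towards the blank. -/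
def BlankShift (G : SimpleGraph V) (X : Set V) (x : V)
    (q : A → V) (l : List (A → V)) (q' : A → V) : Prop :=
  ∃ (y : V) (Q : G.Walk x y), Q.IsPath ∧ (∀ v ∈ Q.support, v ∉ X) ∧ IsBlank q y ∧
    ShiftAlong Q q q' ∧ Realizes G q q' l

/-- Push of the unfinished blocker at `u`: a blank is transported to `u` along a path that avoids
the finished agents and the active agent `r`, which is thus enabled to advance to `u`. It may be
preceded by a clear step, which transports some blank elsewhere, away from the finished agents,
from `r` and from `u`. All components keep two blanks throughout. -/
def Push (G : SimpleGraph V) (F : Set A) (r : A) (u : V)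
    (q : A → V) (l : List (A → V)) (q' : A → V) : Prop :=
  (∃ b, b ≠ r ∧ b ∉ F ∧ q b = u) ∧
  ∃ (m : A → V) (l₁ l₂ : List (A → V)),
    ((m = q ∧ l₁ = []) ∨ ∃ x, BlankShift G (q '' F ∪ {q r, u}) x q l₁ m) ∧
    BlankShift G (q '' F ∪ {q r}) u m l₂ q' ∧
    l = l₁ ++ l₂ ∧ ∀ p ∈ q :: l, TwoBlanks G p

/-- Blocks of a graph: the maximal vertex sets that induce a connected subgraph without
cut vertex. -/
def IsBlock (G : SimpleGraph V) (B : Set V) : Prop :=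
  Maximal (fun B' : Set V => (G.induce B').Connected ∧
    ∀ x ∈ B', (G.induce (B' \ {x})).Preconnected) B

/-- Swap of the active agent `r` with the unfinished blocker at the adjacent vertex `u`: at most
`c` time steps inside a block `B` that contains both vertices and a blank, after which the two
agents have exchanged their positions and all others are back at theirs. Finished agents and agents
outside `B` do not move at all. -/
def Swap (G : SimpleGraph V) (c : ℕ) (F : Set A) (r : A) (u : V)
    (q : A → V) (l : List (A → V)) (q' : A → V) : Prop :=
  ∃ b, b ≠ r ∧ b ∉ F ∧ q b = u ∧ G.Adj (q r) u ∧
    (∃ B, IsBlock G B ∧ q r ∈ B ∧ u ∈ B ∧ (∃ v ∈ B, IsBlank q v) ∧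
      ∀ p ∈ l, ∀ a, (a ∈ F ∨ q a ∉ B → p a = q a) ∧ (q a ∈ B → p a ∈ B)) ∧
    List.IsChain (Transition G) (q :: l) ∧ l.length ≤ c ∧ l.getLastD q = q' ∧
    q' r = u ∧ q' b = q r ∧ ∀ a, a ≠ r → a ≠ b → q' a = q a

/-! ## The algorithm -/

/-- The kinds of primitive operations. -/
inductive Primitive
  | move | rotate | push | swap

/-- The state of a run. -/
structure State (V : Type u) (A : Type v) where
  /-- current configuration -/
  pos : A → V
  /-- finished agents -/
  fin : Set A
  /-- the active agent, if any, with the vertices of its path that are still ahead of it -/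
  active : Option (A × List V)
  /-- the primitive operations emitted so far -/
  ops : List Primitive
  /-- the plan so far: the configurations at the times `1, 2, …` (the one at time `0` is the
  start) -/
  plan : List (A → V)

/-- `w` is a shortest walk between its ends among those that avoid the vertices in `X`. -/
def IsShortestAvoiding {G : SimpleGraph V} (X : Set V) {x y : V} (w : G.Walk x y) : Prop :=
  (∀ v ∈ w.support, v ∉ X) ∧
  ∀ w' : G.Walk x y, (∀ v ∈ w'.support, v ∉ X) → w.length ≤ w'.length

/-- One step of Push-and-Rotate, with the swap length bound `c`. All choices that the algorithm
leaves open (the active agent, the shortest path, the cycle, the blank and the path of a push, the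
moves of a swap) are nondeterministic. A state without successor is one in which the algorithm has
returned or cannot continue. -/
inductive Step (I : LocalInstance V A) (c : ℕ) : State V A → State V A → Prop
  /-- choose an unfinished agent and a shortest path to its target that avoids finished agents -/
  | select {q : A → V} {F : Set A} {ops : List Primitive} {plan : List (A → V)} {r : A}
      (hr : r ∉ F) (w : I.graph.Walk (q r) (I.target r)) (hw : IsShortestAvoiding (q '' F) w) :
      Step I c ⟨q, F, none, ops, plan⟩ ⟨q, F, some (r, w.support.tail), ops, plan⟩
  /-- the active agent is at its target and is frozen there -/
  | finish {q : A → V} {F : Set A} {ops : List Primitive} {plan : List (A → V)} {r : A}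
      {p : List V} (hr : q r = I.target r) :
      Step I c ⟨q, F, some (r, p), ops, plan⟩ ⟨q, insert r F, none, ops, plan⟩
  /-- the next vertex is blank -/
  | move {q q' : A → V} {F : Set A} {ops : List Primitive} {plan l : List (A → V)} {r : A} {x : V}
      {p : List V} (hr : q r ≠ I.target r) (h : Move I.graph r x q l q') :
      Step I c ⟨q, F, some (r, x :: p), ops, plan⟩
        ⟨q', F, some (r, p), ops ++ [.move], plan ++ l⟩
  /-- otherwise, if a rotation is possible, rotate -/
  | rotate {q q' : A → V} {F : Set A} {ops : List Primitive} {plan l : List (A → V)} {r : A} {x : V}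
      {p : List V} (hr : q r ≠ I.target r) (hx : ¬ IsBlank q x)
      (h : Rotate I.graph F r x q l q') :
      Step I c ⟨q, F, some (r, x :: p), ops, plan⟩
        ⟨q', F, some (r, p), ops ++ [.rotate], plan ++ l⟩
  /-- otherwise, if a push is possible, push -/
  | push {q q' : A → V} {F : Set A} {ops : List Primitive} {plan l : List (A → V)} {r : A} {x : V}
      {p : List V} (hr : q r ≠ I.target r) (hx : ¬ IsBlank q x)
      (hrot : ¬ ∃ l₀ q₀, Rotate I.graph F r x q l₀ q₀)
      (h : Push I.graph F r x q l q') :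
      Step I c ⟨q, F, some (r, x :: p), ops, plan⟩
        ⟨q', F, some (r, x :: p), ops ++ [.push], plan ++ l⟩
  /-- otherwise swap, if possible -/
  | swap {q q' : A → V} {F : Set A} {ops : List Primitive} {plan l : List (A → V)} {r : A} {x : V}
      {p : List V} (hr : q r ≠ I.target r) (hx : ¬ IsBlank q x)
      (hrot : ¬ ∃ l₀ q₀, Rotate I.graph F r x q l₀ q₀)
      (hpush : ¬ ∃ l₀ q₀, Push I.graph F r x q l₀ q₀)
      (h : Swap I.graph c F r x q l q') :
      Step I c ⟨q, F, some (r, x :: p), ops, plan⟩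
        ⟨q', F, some (r, p), ops ++ [.swap], plan ++ l⟩

/-- The state before the first step. -/
def State.initial (I : LocalInstance V A) : State V A :=
  ⟨I.start, ∅, none, [], []⟩

/-- `σ` is reached by some run of Push-and-Rotate on `I`; this comprises every state in which the
algorithm returns (`σ.fin = univ`). -/
def Reachable (I : LocalInstance V A) (c : ℕ) (σ : State V A) : Prop :=
  Relation.ReflTransGen (Step I c) (State.initial I) σ

/-- The horizon of a plan: its number of discrete time steps. -/
def State.horizon (σ : State V A) : ℕ := σ.plan.length

/-! ## From the discrete plan to execution -/

/-- The world frame. -/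
abbrev World : Type := EuclideanSpace ℝ (Fin 2)

open scoped Classical in
/-- The dense waypoint list of agent `a`: its vertices in the plan, from its start on, with
consecutive waits collapsed, projected to the cell centers. -/
noncomputable def denseWaypoints (I : LocalInstance V A) (center : V → World) (σ : State V A)
    (a : A) : List World :=
  ((I.start a :: σ.plan.map (fun q => q a)).destutter (· ≠ ·)).map center

/-- The constants of the execution layer. -/
structure ExecConstants where
  /-- bound on cell size: distance of adjacent cell centers, and of a pose from its start cell -/
  cell : ℝ
  /-- reach threshold of the waypoint manager -/
  reach : ℝ
  reach_pos : 0 < reach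
  /-- duration of a simulator tick -/
  dt : ℝ
  dt_pos : 0 < dt
  /-- speed bound -/
  vmax : ℝ
  vmax_pos : 0 < vmax
  /-- tracking progress: at least `gain` per window of `window` ticks -/
  gain : ℝ
  gain_pos : 0 < gain
  window : ℕ
  window_pos : 0 < window

/-- The cell centers fit the graph and the start poses `p₀`. -/
def CellGeometry (κ : ExecConstants) (I : LocalInstance V A) (center : V → World)
    (p₀ : A → World) : Prop :=
  (∀ x y, I.graph.Adj x y → dist (center x) (center y) ≤ κ.cell) ∧
  ∀ a, dist (p₀ a) (center (I.start a)) ≤ κ.cell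

open scoped Classical in
/-- An execution in which the agents track the waypoint lists `W` under the speed bound: `p t a`,
`v t a` are position and velocity of agent `a` at tick `t`, and `k t a` is the index of its active
waypoint, equal to `(W a).length` from the tick on at which the list is completed. The agents may
be delayed and deflected, but an agent whose active waypoint stays the same during a whole window
of ticks gets closer to it by the guaranteed gain, or to within the reach threshold. -/
structure IsTracking (κ : ExecConstants) (W : A → List World)
    (p v : ℕ → A → World) (k : ℕ → A → ℕ) : Prop where
  start : ∀ a, k 0 a = 0
  kinematics : ∀ t a, p (t + 1) a = p t a + κ.dt • v (t + 1) a
  speed : ∀ t a, ‖v t a‖ ≤ κ.vmax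
  manager : ∀ t a, k (t + 1) a =
    if ∃ w, (W a)[k t a]? = some w ∧ dist (p t a) w ≤ κ.reach then k t a + 1 else k t a
  progress : ∀ t a w, (W a)[k t a]? = some w → k (t + κ.window) a = k t a →
    dist (p (t + κ.window) a) w ≤ max (dist (p t a) w - κ.gain) κ.reach

/-- The ticks under coordination: some participant has not yet completed its list. -/
def coordTicks (W : A → List World) (k : ℕ → A → ℕ) : Set ℕ :=
  {t | ∃ a, k t a < (W a).length}

/-- The fraction of ticks under coordination among the first `N` ticks after the trigger. -/
noncomputable def dutyCycle (W : A → List World) (k : ℕ → A → ℕ) (N : ℕ) : ℝ :=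
  ((coordTicks W k ∩ Set.Iio N).ncard : ℝ) / N

/-- The value at `(n, m)` of a polynomial in two variables. -/
noncomputable def polyVal (P : MvPolynomial (Fin 2) ℕ) (n m : ℕ) : ℕ :=
  MvPolynomial.eval ![n, m] P

end PnR

namespace PnR

universe u v

/-! ## Length of the plan of one primitive -/

/-! The run is charged to the vertices of the chosen paths. A selected agent stays active until it
is finished, so there are at most `|A|` selections, and a shortest avoiding path has fewer than
`|V|` edges. Moves, rotations and swaps each consume a path vertex. A push consumes none, but leaves
the next vertex blank, and then rotation, push and swap are all excluded, so a vertex costs at most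
one push and one consuming operation. Hence there are at most `2 |V| |A|` operations
(`Step.opsInvariant`).

A displacement takes at most `|A|` time steps, since each step brings some agent to its final place
for good (`Realizes.length_le`). So a push takes at most `2 |A|` and a swap at most `c`, which
bounds the horizon and thereby every waypoint list.

For the execution, a waypoint becomes active one tick after the agent was within reach of its
predecessor, which is at most one cell away. The initial distance is thus bounded by a constant, and
the guaranteed gain completes the waypoint within `κ.ticks` ticks (`IsTracking.lt_of_dist_le`).
Summing along the lists gives the last bound. -/

/-- A realization of a displacement has at most one time step per agent. -/
theorem Realizes.length_le {V : Type u} {A : Type v} [Fintype A] {G : SimpleGraph V}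
    {q q' : A → V} {l : List (A → V)} (h : Realizes G q q' l) : l.length ≤ Fintype.card A := by
  classical
  -- The displacement stays fixed while the current configuration `x` varies; the number of agents
  -- not yet at their final vertex strictly decreases.
  suffices H : ∀ (l : List (A → V)) (x : A → V),
      List.IsChain (fun x y => Transition G x y ∧ x ≠ y ∧
        ∀ a, y a = x a ∨ (x a = q a ∧ y a = q' a)) (x :: l) →
      l.length ≤ (Finset.univ.filter fun a => x a ≠ q' a).card from
    (H l q h.1).trans (Finset.card_le_univ _)
  intro l
  induction l with
  | nil => intro x _; simp
  | cons y l ih =>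
    intro x hx
    rw [List.isChain_cons_cons] at hx
    obtain ⟨⟨-, hne, hmove⟩, hchain⟩ := hx
    have hlt : (Finset.univ.filter fun a => y a ≠ q' a).card <
        (Finset.univ.filter fun a => x a ≠ q' a).card := by
      refine Finset.card_lt_card (Finset.ssubset_iff_of_subset ?_ |>.2 ?_)
      · intro a ha
        simp only [Finset.mem_filter, Finset.mem_univ, true_and] at ha ⊢
        rcases hmove a with h | h
        · rwa [← h]
        · exact absurd h.2 ha
      · obtain ⟨a, ha⟩ := Function.ne_iff.1 hne
        rcases hmove a with h | h
        · exact absurd h.symm ha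
        · exact ⟨a, by simpa [← h.2] using ha, by simp [h.2]⟩
    have := ih y hchain
    simp only [List.length_cons]
    omega

theorem Realizes.isChain {V : Type u} {A : Type v} {G : SimpleGraph V}
    {q q' : A → V} {l : List (A → V)} (h : Realizes G q q' l) :
    List.IsChain (Transition G) (q :: l) :=
  h.1.imp fun _ _ h => h.1

/-- The list `l` is a sequence of transitions that leads from `q` to `q'`. -/
def Leads {V : Type u} {A : Type v} (G : SimpleGraph V) (q q' : A → V) (l : List (A → V)) : Prop :=
  List.IsChain (Transition G) (q :: l) ∧ l.getLastD q = q'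

theorem Leads.nil {V : Type u} {A : Type v} {G : SimpleGraph V} (q : A → V) : Leads G q q [] :=
  ⟨List.isChain_singleton _, rfl⟩

theorem Leads.append {V : Type u} {A : Type v} {G : SimpleGraph V} {q₁ q₂ q₃ : A → V}
    {l₁ l₂ : List (A → V)} (h₁ : Leads G q₁ q₂ l₁) (h₂ : Leads G q₂ q₃ l₂) :
    Leads G q₁ q₃ (l₁ ++ l₂) := by
  induction l₁ generalizing q₁ with
  | nil =>
    obtain ⟨-, rfl⟩ := h₁
    exact h₂
  | cons y l ih =>
    obtain ⟨hc, hl⟩ := h₁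
    rw [List.isChain_cons_cons] at hc
    have := ih (q₁ := y) ⟨hc.2, by rwa [List.getLastD_cons] at hl⟩
    exact ⟨by rw [List.cons_append, List.isChain_cons_cons]; exact ⟨hc.1, this.1⟩,
      by simpa only [List.cons_append, List.getLastD_cons] using this.2⟩

theorem Realizes.leads {V : Type u} {A : Type v} {G : SimpleGraph V}
    {q q' : A → V} {l : List (A → V)} (h : Realizes G q q' l) : Leads G q q' l :=
  ⟨h.isChain, h.2⟩

theorem Move.leads {V : Type u} {A : Type v} {G : SimpleGraph V} {r : A} {x : V}
    {q q' : A → V} {l : List (A → V)} (h : Move G r x q l q') : Leads G q q' l := by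
  obtain ⟨-, -, -, ht, rfl⟩ := h
  exact ⟨by simpa using ht, rfl⟩

theorem Rotate.realizes {V : Type u} {A : Type v} {G : SimpleGraph V} {F : Set A} {r : A} {x : V}
    {q q' : A → V} {l : List (A → V)} (h : Rotate G F r x q l q') : Realizes G q q' l := by
  obtain ⟨-, -, -, -, -, -, h⟩ := h
  exact h

theorem BlankShift.realizes {V : Type u} {A : Type v} {G : SimpleGraph V} {X : Set V} {x : V}
    {q q' : A → V} {l : List (A → V)} (h : BlankShift G X x q l q') : Realizes G q q' l := by
  obtain ⟨-, -, -, -, -, -, h⟩ := h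
  exact h

theorem Push.leads {V : Type u} {A : Type v} {G : SimpleGraph V} {F : Set A} {r : A} {x : V}
    {q q' : A → V} {l : List (A → V)} (h : Push G F r x q l q') : Leads G q q' l := by
  obtain ⟨-, m, l₁, l₂, hm, h₂, rfl, -⟩ := h
  refine Leads.append (q₂ := m) ?_ h₂.realizes.leads
  rcases hm with ⟨rfl, rfl⟩ | ⟨_, h₁⟩
  · exact Leads.nil _
  · exact h₁.realizes.leads

/-- The factor two accounts for the optional clear step. -/
theorem Push.length_le {V : Type u} {A : Type v} [Fintype A] {G : SimpleGraph V} {F : Set A}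
    {r : A} {x : V} {q q' : A → V} {l : List (A → V)} (h : Push G F r x q l q') :
    l.length ≤ 2 * Fintype.card A := by
  obtain ⟨-, m, l₁, l₂, hm, h₂, rfl, -⟩ := h
  have hl₂ := h₂.realizes.length_le
  have hl₁ : l₁.length ≤ Fintype.card A := by
    rcases hm with ⟨rfl, rfl⟩ | ⟨_, h₁⟩
    · simp
    · exact h₁.realizes.length_le
  rw [List.length_append]
  omega

theorem Swap.leads {V : Type u} {A : Type v} {G : SimpleGraph V} {c : ℕ} {F : Set A} {r : A}
    {x : V} {q q' : A → V} {l : List (A → V)} (h : Swap G c F r x q l q') : Leads G q q' l := by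
  obtain ⟨-, -, -, -, -, -, hc, -, hl, -⟩ := h
  exact ⟨hc, hl⟩

theorem Swap.length_le {V : Type u} {A : Type v} {G : SimpleGraph V} {c : ℕ} {F : Set A} {r : A}
    {x : V} {q q' : A → V} {l : List (A → V)} (h : Swap G c F r x q l q') : l.length ≤ c := by
  obtain ⟨-, -, -, -, -, -, -, hl, -⟩ := h
  exact hl

/-- After a blank has been transported to `x`, the vertex `x` is blank. -/
theorem BlankShift.isBlank {V : Type u} {A : Type v} {G : SimpleGraph V} {X : Set V} {x : V}
    {q q' : A → V} {l : List (A → V)} (h : BlankShift G X x q l q') : IsBlank q' x := by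
  obtain ⟨y, Q, hQ, -, hy, ⟨hon, hoff⟩, -⟩ := h
  rintro ⟨a, ha⟩
  by_cases hmem : q a ∈ Q.support
  · obtain ⟨i, hi, hile⟩ := SimpleGraph.Walk.mem_support_iff_exists_getVert.1 hmem
    rcases hile.lt_or_eq with hlt | rfl
    · have h1 := hon a i hlt hi.symm
      -- An agent arriving at `x` would make the path return to its first vertex.
      have h0 : Q.getVert (i + 1) = Q.getVert 0 := by
        rw [← h1, ha, SimpleGraph.Walk.getVert_zero]
      have := hQ.getVert_injOn (by simpa using hlt) (by simp) h0
      omega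
    · rw [SimpleGraph.Walk.getVert_length] at hi
      exact hy ⟨a, hi.symm⟩
  · exact hmem (by rw [← hoff a hmem, ha]; exact Q.start_mem_support)

theorem Push.isBlank {V : Type u} {A : Type v} {G : SimpleGraph V} {F : Set A} {r : A} {x : V}
    {q q' : A → V} {l : List (A → V)} (h : Push G F r x q l q') : IsBlank q' x := by
  obtain ⟨-, _, _, _, -, h₂, -, -⟩ := h
  exact h₂.isBlank

/-! ## Invariants of a run -/

/-- A shortest avoiding walk has fewer steps than the graph has vertices. -/
theorem IsShortestAvoiding.length_lt {V : Type u} [Fintype V] {G : SimpleGraph V} {X : Set V}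
    {x y : V} {w : G.Walk x y} (hw : IsShortestAvoiding X w) : w.length < Fintype.card V := by
  classical
  -- Erasing the loops gives a competing path that still avoids `X`.
  exact (hw.2 w.bypass fun v hv => hw.1 v (w.support_bypass_subset_support hv)).trans_lt
    w.bypass_isPath.length_lt

/-- The operations emitted so far, together with two for every vertex that is still ahead of the
active agent, are at most `2 |V|` per agent selected so far; one more is allowed between a push and
the move that it enables. -/
def OpsInvariant {V : Type u} {A : Type v} (n : ℕ) (σ : State V A) : Prop :=
  match σ.active with
  | none => σ.ops.length ≤ 2 * n * σ.fin.ncard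
  | some (r, p) => r ∉ σ.fin ∧
      (σ.ops.length + 2 * p.length ≤ 2 * n * (σ.fin.ncard + 1) ∨
        ∃ x p', p = x :: p' ∧ IsBlank σ.pos x ∧
          σ.ops.length + 2 * p.length ≤ 2 * n * (σ.fin.ncard + 1) + 1)

theorem Step.opsInvariant {V : Type u} {A : Type v} [Fintype V] [Finite A]
    {I : LocalInstance V A} {c : ℕ} {σ τ : State V A} (h : Step I c σ τ)
    (hσ : OpsInvariant (Fintype.card V) σ) : OpsInvariant (Fintype.card V) τ := by
  cases h with
  | @select q F ops plan r hr w hw =>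
    refine ⟨hr, Or.inl ?_⟩
    have h1 := hw.length_lt
    have h2 : w.support.tail.length = w.length := by simp
    simp only [OpsInvariant] at hσ
    -- The new path is paid for by the additional `2 * n` granted to the active agent.
    simp only [h2, mul_add]
    omega
  | @finish q F ops plan r p hr =>
    obtain ⟨hF, hσ⟩ := hσ
    simp only [OpsInvariant]
    dsimp only at hF hσ
    rw [Set.ncard_insert_of_notMem hF]
    -- Any unused budget is dropped. In the second case the unvisited vertex `x` still carries two
    -- units, which absorb the extra one.
    rcases hσ with h | ⟨x, p', rfl, -, h⟩
    · omega
    · rw [List.length_cons] at h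
      omega
  | move hr h =>
    obtain ⟨hF, hσ⟩ := hσ
    refine ⟨hF, Or.inl ?_⟩
    simp only [List.length_append, List.length_cons, List.length_nil] at hσ ⊢
    -- Consuming a vertex frees two units: one pays for the move, the other repays a preceding push.
    rcases hσ with h | ⟨_, _, -, -, h⟩ <;> omega
  | rotate hr hx h =>
    obtain ⟨hF, hσ⟩ := hσ
    refine ⟨hF, Or.inl ?_⟩
    rcases hσ with h | ⟨_, _, hp, hb, h⟩
    · simp only [List.length_append, List.length_cons, List.length_nil] at h ⊢
      omega
    · cases hp
      exact absurd hb hx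
  | @push q q' F ops plan l r x p hr hx hrot h =>
    obtain ⟨hF, hσ⟩ := hσ
    -- The path is unchanged, so the push is paid for with the one unit of credit that a blank next
    -- vertex allows.
    refine ⟨hF, Or.inr ⟨x, p, rfl, h.isBlank, ?_⟩⟩
    rcases hσ with h | ⟨_, _, hp, hb, h⟩
    · simp only [List.length_append, List.length_cons, List.length_nil] at h ⊢
      omega
    · cases hp
      exact absurd hb hx
  | swap hr hx hrot hpush h =>
    obtain ⟨hF, hσ⟩ := hσ
    refine ⟨hF, Or.inl ?_⟩
    rcases hσ with h | ⟨_, _, hp, hb, h⟩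
    · simp only [List.length_append, List.length_cons, List.length_nil] at h ⊢
      omega
    · cases hp
      exact absurd hb hx

theorem Reachable.ops_length_le {V : Type u} {A : Type v} [Fintype V] [Fintype A]
    {I : LocalInstance V A} {c : ℕ} {σ : State V A} (h : Reachable I c σ) :
    σ.ops.length ≤ 2 * Fintype.card V * Fintype.card A := by
  have hinv : OpsInvariant (Fintype.card V) σ := by
    induction h with
    | refl => simp [OpsInvariant, State.initial]
    | tail _ hstep ih => exact hstep.opsInvariant ih
  obtain ⟨q, F, act, ops, plan⟩ := σ
  rcases act with _ | ⟨r, p⟩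
  · simp only [OpsInvariant] at hinv
    exact hinv.trans (Nat.mul_le_mul_left _ ((Set.ncard_le_card F).trans_eq Nat.card_eq_fintype_card))
  · obtain ⟨hr, hinv⟩ := hinv
    have hF : F.ncard + 1 ≤ Fintype.card A := by
      rw [← Set.ncard_insert_of_notMem hr, ← Nat.card_eq_fintype_card]
      exact Set.ncard_le_card _
    have hmul := Nat.mul_le_mul_left (2 * Fintype.card V) hF
    rcases hinv with h | ⟨x, p', rfl, -, h⟩
    · simp only at h ⊢
      omega
    · simp only [List.length_cons] at h ⊢
      omega

/-- The plan emitted so far leads from the start configuration to the current one, and has a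
bounded number of time steps per operation. -/
theorem Reachable.plan {V : Type u} {A : Type v} [Fintype A]
    {I : LocalInstance V A} {c : ℕ} {σ : State V A} (h : Reachable I c σ) :
    Leads I.graph I.start σ.pos σ.plan ∧
      σ.plan.length ≤ σ.ops.length * (2 * Fintype.card A + c + 1) := by
  -- The factor adds up the bounds `2 |A|` (rotation, push), `c` (swap) and `1` (move), which avoids
  -- a maximum.
  induction h with
  | refl => exact ⟨Leads.nil _, by simp [State.initial]⟩
  | tail _ hstep ih =>
    obtain ⟨hl, hn⟩ := ih
    cases hstep with
    | select | finish => exact ⟨hl, hn⟩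
    | move hr h =>
      have : _ := h.2.2.2.2
      refine ⟨hl.append h.leads, ?_⟩
      simp only [List.length_append, List.length_cons, List.length_nil, add_mul, this] at hn ⊢
      omega
    | rotate hr hx h =>
      have := h.realizes.length_le
      refine ⟨hl.append h.realizes.leads, ?_⟩
      simp only [List.length_append, List.length_cons, List.length_nil, add_mul] at hn ⊢
      omega
    | push hr hx hrot h =>
      have := h.length_le
      refine ⟨hl.append h.leads, ?_⟩
      simp only [List.length_append, List.length_cons, List.length_nil, add_mul] at hn ⊢
      omega
    | swap hr hx hrot hpush h =>
      have := h.length_le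
      refine ⟨hl.append h.leads, ?_⟩
      simp only [List.length_append, List.length_cons, List.length_nil, add_mul] at hn ⊢
      omega

theorem Reachable.horizon_le {V : Type u} {A : Type v} [Fintype V] [Fintype A]
    {I : LocalInstance V A} {c : ℕ} {σ : State V A} (h : Reachable I c σ) :
    σ.horizon ≤ 2 * Fintype.card V * Fintype.card A * (2 * Fintype.card A + c + 1) :=
  h.plan.2.trans (Nat.mul_le_mul_right _ h.ops_length_le)

/-! ## Waypoint lists -/

theorem length_denseWaypoints_le {V : Type u} {A : Type v} (I : LocalInstance V A)
    (center : V → World) (σ : State V A) (a : A) :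
    (denseWaypoints I center σ a).length ≤ σ.horizon + 1 := by
  classical
  simpa [denseWaypoints, State.horizon] using
    (List.destutter_sublist (· ≠ ·) (I.start a :: σ.plan.map (fun q => q a))).length_le

theorem Reachable.sum_length_denseWaypoints_le {V : Type u} {A : Type v} [Fintype V] [Fintype A]
    {I : LocalInstance V A} {c : ℕ} {σ : State V A} (h : Reachable I c σ) (center : V → World) :
    ∑ a, (denseWaypoints I center σ a).length ≤ Fintype.card A *
      (2 * Fintype.card V * Fintype.card A * (2 * Fintype.card A + c + 1) + 1) := by
  refine (Finset.sum_le_card_nsmul _ _ _ fun a _ =>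
    (length_denseWaypoints_le I center σ a).trans (Nat.succ_le_succ h.horizon_le)).trans_eq ?_
  simp

/-- Collapsing consecutive repetitions turns a chain of steps and waits into a chain of steps. -/
theorem isChain_destutter' {α : Type*} [DecidableEq α] {R : α → α → Prop} (l : List α) (a : α)
    (h : List.IsChain (fun x y => y = x ∨ R x y) (a :: l)) :
    List.IsChain R (l.destutter' (· ≠ ·) a) ∧
      ∀ b, R b a → List.IsChain R (b :: l.destutter' (· ≠ ·) a) := by
  -- The second clause strengthens the induction: it allows an earlier vertex to be put in front
  -- once the waits at `a` are collapsed.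
  induction l generalizing a with
  | nil => simp
  | cons y l ih =>
    rw [List.isChain_cons_cons] at h
    by_cases hay : a = y
    · subst hay
      simpa [List.destutter'] using ih a h.2
    · rw [List.destutter'_cons_pos l hay]
      have hc := (ih y h.2).2 a (h.1.resolve_left (Ne.symm hay))
      exact ⟨hc, fun b hb => List.isChain_cons_cons.2 ⟨hb, hc⟩⟩

theorem head?_destutter' {α : Type*} (R : α → α → Prop) [DecidableRel R] (l : List α) (a : α) :
    (l.destutter' R a).head? = some a := by
  induction l generalizing a with
  | nil => rfl
  | cons y l ih =>
    rw [List.destutter']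
    split_ifs
    · rfl
    · exact ih a

/-- Once waits are collapsed, only moves along edges remain between successive waypoints. -/
theorem isChain_denseWaypoints {V : Type u} {A : Type v} {I : LocalInstance V A} {σ : State V A}
    {q : A → V} (h : Leads I.graph I.start q σ.plan) (center : V → World) {d : ℝ}
    (hd : ∀ x y, I.graph.Adj x y → dist (center x) (center y) ≤ d) (a : A) :
    List.IsChain (fun x y => dist x y ≤ d) (denseWaypoints I center σ a) := by
  classical
  have h1 : List.IsChain (fun x y => y = x ∨ I.graph.Adj x y)
      ((I.start :: σ.plan).map fun q => q a) :=
    (List.isChain_map _).2 (h.1.imp fun x y hxy => hxy.wait_or_adj a)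
  exact (List.isChain_map _).2 ((isChain_destutter' _ _ h1).1.imp fun x y hxy => hd x y hxy)

theorem denseWaypoints_zero {V : Type u} {A : Type v} (I : LocalInstance V A)
    (center : V → World) (σ : State V A) (a : A) :
    (denseWaypoints I center σ a)[0]? = some (center (I.start a)) := by
  classical
  rw [← List.head?_eq_getElem?, denseWaypoints, List.head?_map, List.destutter,
    head?_destutter', Option.map_some]

/-! ## Execution -/

/-- A bound on the number of ticks for which a waypoint is active. -/
noncomputable def ExecConstants.ticks (κ : ExecConstants) : ℕ :=
  κ.window * ⌈(κ.reach + κ.dt * κ.vmax + κ.cell) / κ.gain⌉₊ + 1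

section Tracking

variable {A : Type v} {κ : ExecConstants} {W : A → List World} {p v : ℕ → A → World}
  {k : ℕ → A → ℕ}

theorem IsTracking.le_succ (h : IsTracking κ W p v k) (a : A) (t : ℕ) : k t a ≤ k (t + 1) a := by
  rw [h.manager t a]
  split_ifs <;> omega

theorem IsTracking.monotone (h : IsTracking κ W p v k) (a : A) : Monotone fun t => k t a :=
  monotone_nat_of_le_succ (h.le_succ a)

theorem IsTracking.dist_succ_le (h : IsTracking κ W p v k) (a : A) (t : ℕ) :
    dist (p (t + 1) a) (p t a) ≤ κ.dt * κ.vmax := by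
  rw [h.kinematics t a, dist_eq_norm, add_sub_cancel_left, norm_smul, Real.norm_of_nonneg
    κ.dt_pos.le]
  exact mul_le_mul_of_nonneg_left (h.speed _ a) κ.dt_pos.le

/-- As long as the active waypoint does not change, the distance to it decreases by the guaranteed
gain per window, down to the reach threshold. -/
theorem IsTracking.dist_le_of_eq (h : IsTracking κ W p v k) {a : A} {t : ℕ} {w : World}
    (hw : (W a)[k t a]? = some w) (n : ℕ) (hk : k (t + κ.window * n) a = k t a) :
    dist (p (t + κ.window * n) a) w ≤ max (dist (p t a) w - n * κ.gain) κ.reach := by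
  induction n with
  | zero => simp
  | succ n ih =>
    have h1 : k (t + κ.window * n) a = k t a :=
      le_antisymm (hk ▸ h.monotone a (by rw [mul_add]; omega)) (h.monotone a (by omega))
    have h2 := h.progress (t + κ.window * n) a w (by rwa [h1])
      (by rw [h1, add_assoc, ← Nat.mul_succ, hk])
    rw [add_assoc, ← Nat.mul_succ] at h2
    refine h2.trans (max_le ?_ (le_max_right _ _))
    rcases le_max_iff.1 (ih h1) with h3 | h3
    · refine le_max_of_le_left ?_
      push_cast
      linarith
    · exact le_max_of_le_right (by linarith [κ.gain_pos])

/-- A waypoint that is activated within the distance `reach + dt * vmax + cell` is completed after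
at most `ticks` ticks. -/
theorem IsTracking.lt_of_dist_le (h : IsTracking κ W p v k) {a : A} {t : ℕ} {w : World}
    (hw : (W a)[k t a]? = some w)
    (hd : dist (p t a) w ≤ κ.reach + κ.dt * κ.vmax + κ.cell) :
    k t a < k (t + κ.ticks) a := by
  set n := ⌈(κ.reach + κ.dt * κ.vmax + κ.cell) / κ.gain⌉₊ with hn
  have hticks : κ.ticks = κ.window * n + 1 := rfl
  rw [hticks, ← add_assoc]
  -- Either the index has already advanced, or `n` windows have used up the whole initial distance;
  -- the final tick is the one at which the manager reacts.
  rcases (h.monotone a (Nat.le_add_right t (κ.window * n))).lt_or_eq with hlt | heq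
  · exact hlt.trans_le (h.le_succ a _)
  · have h1 := h.dist_le_of_eq hw n heq.symm
    have h2 : κ.reach + κ.dt * κ.vmax + κ.cell ≤ n * κ.gain :=
      (div_le_iff₀ κ.gain_pos).1 (Nat.le_ceil _)
    have h3 : dist (p (t + κ.window * n) a) w ≤ κ.reach :=
      h1.trans (max_le (by linarith [κ.reach_pos]) le_rfl)
    simp only at heq
    rw [h.manager (t + κ.window * n) a, ← heq, if_pos ⟨w, hw, h3⟩]
    omega

/-- A waypoint is close to the agent when it becomes active. -/
theorem IsTracking.dist_of_activated (h : IsTracking κ W p v k) {a : A}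
    (hW : List.IsChain (fun x y => dist x y ≤ κ.cell) (W a)) {t : ℕ} {w : World}
    (hk : k (t + 1) a ≠ k t a) (hw : (W a)[k (t + 1) a]? = some w) :
    dist (p (t + 1) a) w ≤ κ.reach + κ.dt * κ.vmax + κ.cell := by
  have hm := h.manager t a
  split_ifs at hm with hc
  · obtain ⟨w', hw', hd⟩ := hc
    rw [hm] at hw
    obtain ⟨hlt, rfl⟩ := List.getElem?_eq_some_iff.1 hw
    obtain ⟨hlt', rfl⟩ := List.getElem?_eq_some_iff.1 hw'
    have h1 := List.isChain_iff_getElem.1 hW _ hlt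
    have h2 := h.dist_succ_le a t
    -- The three legs are one tick of motion, the reach threshold, and one cell.
    have h3 := dist_triangle4 (p (t + 1) a) (p t a) (W a)[k t a] (W a)[k t a + 1]
    linarith
  · exact absurd hm hk

/-- The distance bound at activation is carried through the induction because it is what bounds the
time to the next activation. The value `j = (W a).length` is allowed: there the list is completed.
-/
theorem IsTracking.exists_activation (h : IsTracking κ W p v k) {a : A}
    (hW : List.IsChain (fun x y => dist x y ≤ κ.cell) (W a))
    (h₀ : ∀ w, (W a)[0]? = some w → dist (p 0 a) w ≤ κ.cell) (j : ℕ) (hj : j ≤ (W a).length) :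
    ∃ t ≤ j * κ.ticks, k t a = j ∧ ∀ w, (W a)[j]? = some w →
      dist (p t a) w ≤ κ.reach + κ.dt * κ.vmax + κ.cell := by
  induction j with
  | zero =>
    refine ⟨0, by simp, h.start a, fun w hw => (h₀ w hw).trans ?_⟩
    have := mul_pos κ.dt_pos κ.vmax_pos
    linarith [κ.reach_pos]
  | succ j ih =>
    classical
    obtain ⟨t, ht, hkt, hd⟩ := ih (by omega)
    have hw : (W a)[j]? = some (W a)[j] := List.getElem?_eq_getElem _
    -- The first tick with index above `j` is the required one: the index grows by at most one per
    -- tick, so it equals `j + 1` there and has just changed.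
    have hex : ∃ s, j < k (t + s) a :=
      ⟨κ.ticks, by simpa only [hkt] using h.lt_of_dist_le (hkt ▸ hw) (hd _ hw)⟩
    have hle : Nat.find hex ≤ κ.ticks :=
      Nat.find_min' hex (by simpa only [hkt] using h.lt_of_dist_le (hkt ▸ hw) (hd _ hw))
    obtain ⟨s, hs⟩ : ∃ s, Nat.find hex = s + 1 := by
      refine Nat.exists_eq_succ_of_ne_zero fun h0 => ?_
      have := Nat.find_spec hex
      rw [h0, add_zero, hkt] at this
      exact lt_irrefl _ this
    have h1 : j < k (t + s + 1) a := by
      have := Nat.find_spec hex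
      rwa [hs] at this
    have h2 : k (t + s) a ≤ j := not_lt.1 (Nat.find_min hex (by omega))
    have h3 : k (t + s + 1) a = j + 1 := by
      have := h.manager (t + s) a
      split_ifs at this <;> omega
    refine ⟨t + s + 1, by rw [add_mul]; omega, h3, fun w hw => ?_⟩
    exact h.dist_of_activated hW (by omega) (by rwa [h3])

/-- All ticks under coordination lie in an initial segment. -/
theorem IsTracking.coordTicks_subset [Fintype A] (h : IsTracking κ W p v k)
    (hW : ∀ a, List.IsChain (fun x y => dist x y ≤ κ.cell) (W a))
    (h₀ : ∀ a w, (W a)[0]? = some w → dist (p 0 a) w ≤ κ.cell) :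
    coordTicks W k ⊆ Set.Iio (κ.ticks * ∑ a, (W a).length) := by
  rintro s ⟨a, ha⟩
  obtain ⟨t, ht, hkt, -⟩ := h.exists_activation (hW a) (h₀ a) _ le_rfl
  have hst : s < t := by
    by_contra hle
    have : k t a ≤ k s a := h.monotone a (not_lt.1 hle)
    omega
  have hsum : (W a).length ≤ ∑ a, (W a).length :=
    Finset.single_le_sum (f := fun a => (W a).length) (fun _ _ => Nat.zero_le _)
      (Finset.mem_univ a)
  refine Set.mem_Iio.2 (hst.trans_le (ht.trans ?_))
  rw [mul_comm]
  exact Nat.mul_le_mul_left _ hsum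

end Tracking

/-- Finiteness must be supplied separately, since `ncard` is `0` on infinite sets. -/
theorem dutyCycle_le {A : Type v} {W : A → List World} {k : ℕ → A → ℕ}
    (hfin : (coordTicks W k).Finite) {B : ℕ} (hB : (coordTicks W k).ncard ≤ B) (N : ℕ) :
    dutyCycle W k N ≤ (B : ℝ) / N := by
  unfold dutyCycle
  gcongr
  exact (Set.ncard_le_ncard Set.inter_subset_left hfin).trans hB

/-! ## The polynomials -/

open MvPolynomial in
/-- The bound on the number of primitive operations. -/
noncomputable def opsPoly : MvPolynomial (Fin 2) ℕ := C 2 * X 0 * X 1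

open MvPolynomial in
/-- The bound on the horizon. -/
noncomputable def horizonPoly (c : ℕ) : MvPolynomial (Fin 2) ℕ :=
  opsPoly * (C 2 * X 1 + C c + 1)

open MvPolynomial in
/-- The bound on the total length of the waypoint lists. -/
noncomputable def waypointPoly (c : ℕ) : MvPolynomial (Fin 2) ℕ := X 1 * (horizonPoly c + 1)

theorem polyVal_opsPoly (n m : ℕ) : polyVal opsPoly n m = 2 * n * m := by
  simp [polyVal, opsPoly]

theorem polyVal_horizonPoly (c n m : ℕ) :
    polyVal (horizonPoly c) n m = 2 * n * m * (2 * m + c + 1) := by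
  simp [polyVal, horizonPoly, opsPoly]

theorem polyVal_waypointPoly (c n m : ℕ) :
    polyVal (waypointPoly c) n m = m * (2 * n * m * (2 * m + c + 1) + 1) := by
  simp [polyVal, waypointPoly, horizonPoly, opsPoly]

theorem polyVal_C_mul (b : ℕ) (P : MvPolynomial (Fin 2) ℕ) (n m : ℕ) :
    polyVal (MvPolynomial.C b * P) n m = b * polyVal P n m := by
  simp [polyVal]

end PnR

theorem mainTheorem2 (c : ℕ) :
    (∃ Pops Phor Pway : MvPolynomial (Fin 2) ℕ,
      ∀ (V : Type*) (A : Type*) [Fintype V] [Fintype A] (I : PnR.LocalInstance V A),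
        PnR.TwoBlanks I.graph I.start →
        ∀ σ : PnR.State V A, PnR.Reachable I c σ →
          σ.ops.length ≤ PnR.polyVal Pops (Fintype.card V) (Fintype.card A) ∧
          σ.horizon ≤ PnR.polyVal Phor (Fintype.card V) (Fintype.card A) ∧
          ∀ center : V → PnR.World,
            ∑ a, (PnR.denseWaypoints I center σ a).length ≤
              PnR.polyVal Pway (Fintype.card V) (Fintype.card A)) ∧
    (∀ κ : PnR.ExecConstants, ∃ Pexec : MvPolynomial (Fin 2) ℕ,
      ∀ (V : Type*) (A : Type*) [Fintype V] [Fintype A] (I : PnR.LocalInstance V A),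
        PnR.TwoBlanks I.graph I.start →
        ∀ σ : PnR.State V A, PnR.Reachable I c σ →
        ∀ (center : V → PnR.World) (p v : ℕ → A → PnR.World) (k : ℕ → A → ℕ),
          PnR.CellGeometry κ I center (p 0) →
          PnR.IsTracking κ (PnR.denseWaypoints I center σ) p v k →
          (PnR.coordTicks (PnR.denseWaypoints I center σ) k).Finite ∧
          (PnR.coordTicks (PnR.denseWaypoints I center σ) k).ncard ≤
            PnR.polyVal Pexec (Fintype.card V) (Fintype.card A) ∧
          ∀ N : ℕ, 0 < N →
            PnR.dutyCycle (PnR.denseWaypoints I center σ) k N ≤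
              (PnR.polyVal Pexec (Fintype.card V) (Fintype.card A) : ℝ) / N) := by
  refine ⟨⟨PnR.opsPoly, PnR.horizonPoly c, PnR.waypointPoly c, ?_⟩, fun κ =>
    ⟨MvPolynomial.C κ.ticks * PnR.waypointPoly c, ?_⟩⟩
  · intro V A _ _ I _ σ hσ
    rw [PnR.polyVal_opsPoly, PnR.polyVal_horizonPoly, PnR.polyVal_waypointPoly]
    exact ⟨hσ.ops_length_le, hσ.horizon_le, hσ.sum_length_denseWaypoints_le⟩
  · intro V A _ _ I _ σ hσ center p v k hgeo htrack
    have hsub := htrack.coordTicks_subset (PnR.isChain_denseWaypoints hσ.plan.1 center hgeo.1)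
      (fun a w hw => by
        rw [PnR.denseWaypoints_zero, Option.some_inj] at hw
        exact hw ▸ hgeo.2 a)
    have hfin := (Set.finite_Iio _).subset hsub
    have hcard := (Set.ncard_le_ncard hsub (Set.finite_Iio _)).trans_eq
      (by rw [Set.ncard_eq_toFinset_card', Set.toFinset_Iio, Nat.card_Iio])
    have hB := hcard.trans (Nat.mul_le_mul_left κ.ticks (hσ.sum_length_denseWaypoints_le center))
    rw [← PnR.polyVal_waypointPoly, ← PnR.polyVal_C_mul] at hB
    exact ⟨hfin, hB, fun N _ => PnR.dutyCycle_le hfin hB N⟩
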